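/- Let $n, K \ge 0$ and $m_1,\dots,m_K \ge 0$ be integers and let $\tau \ge 1$ be an integer. For $i\in[K]=\{1,\dots,K\}$ let $B_i$ be a real $n\times m_i$ matrix of full column rank, $\operatorname{rank} B_i = m_i$. Let $\Lambda_1,\dots,\Lambda_K$ be random $n\times n$ diagonal matrices, defined on a common probability space, whose $Kn$ diagonal entries have a continuous joint distribution, i.e. their joint law on $\mathbb{R}^{Kn}$ is absolutely continuous with respect to Lebesgue measure (no independence is assumed). Put $R=\min\left(\sum_{i=1}^K m_i,\, n\right)$. For $Y\subseteq[m_i]$ let $\mathcal{B}_{i,*,Y}\subseteq\mathbb{R}^n$ be the span of the columns of $B_i$ with indices in $Y$, and for $J\subseteq[n]$ let $\mathcal{S}_J\subseteq\mathbb{R}^n$ be the subspace of all vectors whose entries outside $J$ are zero. Then the following two statements are equivalent: (C1) $\operatorname{rank}\left[\Lambda_1B_1\ \ \Lambda_2B_2\ \cdots\ \Lambda_KB_K\right]\le R-\tau$ almost surely. (C2) For all $Y_i\subseteq[m_i]$, $i\in[K]$, with $\sum_{i=1}^K|Y_i|=R$, there exists $J\subseteq[n]$ such that $\sum_{i=1}^K\dim\left(\mathcal{S}_J\cap\mathcal{B}_{i,*,Y_i}\right)\ge|J|+\tau$.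 -/

import Mathlib

/-- The horizontal concatenation `[Λ₁ B₁  Λ₂ B₂  ⋯  Λ_K B_K]`, where `Λᵢ` is the diagonal matrix
with diagonal entries `d i 1, …, d i n`. Its columns are indexed by the pairs (block, column of
the block). -/
def scaledConcat {n K : ℕ} {m : Fin K → ℕ} (d : Fin K → Fin n → ℝ)
    (B : (i : Fin K) → Matrix (Fin n) (Fin (m i)) ℝ) :
    Matrix (Fin n) ((i : Fin K) × Fin (m i)) ℝ :=
  Matrix.of fun r c => (Matrix.diagonal (d c.1) * B c.1) r c.2

/-- The sparse subspace `S_J` of `ℝⁿ`: all vectors whose entries outside `J` vanish. -/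
def sparseSubspace {n : ℕ} (J : Finset (Fin n)) : Submodule ℝ (Fin n → ℝ) where
  carrier := {v | ∀ j, j ∉ J → v j = 0}
  zero_mem' := fun _ _ => rfl
  add_mem' := by
    intro a b ha hb j hj
    simp [ha j hj, hb j hj]
  smul_mem' := by
    intro c a ha j hj
    simp [ha j hj]

/-- The subspace of `ℝⁿ` spanned by the columns of `B` with indices in `Y`. -/
def colSpan {n m : ℕ} (B : Matrix (Fin n) (Fin m) ℝ) (Y : Finset (Fin m)) :
    Submodule ℝ (Fin n → ℝ) :=
  Submodule.span ℝ ((fun y r => B r y) '' (Y : Set (Fin m)))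

open MeasureTheory Matrix

/-! Fix a choice of `R` columns and a scaling, giving a matrix `M`. Let `V` be the space of
coefficient vectors all of whose block contributions lie in `S_J`; its dimension is the sum in (C2),
and `M` maps `V` into `S_J`. Hence rank `M` ≤ |J| + R − dim `V` for every `J`
(`finrank_sparseCoeff_add_rank_le`). Applied to `R` columns that carry the full rank, this gives
(C2) → (C1), for every scaling.

For the converse, a generic scaling maximizes the rank (`ae_forall_rank_le`), and at a maximum, left
and right kernel vectors satisfy `y r * (Bᵢ xᵢ) r = 0` in each block. Taking for `J` the rows on
which all left kernel vectors vanish turns the rank bound into an equality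
(`exists_card_add_card_le`). -/

/-! ### Generic rank in linear families of matrices -/

/-- A matrix of rank `r` can be compressed to the identity matrix of size `r`. -/
lemma Matrix.exists_mul_mul_eq_one {ρ C : Type*} [Fintype ρ] [Fintype C] [DecidableEq ρ]
    [DecidableEq C] (M : Matrix ρ C ℝ) :
    ∃ (P : Matrix (Fin M.rank) ρ ℝ) (Q : Matrix C (Fin M.rank) ℝ), P * M * Q = 1 := by
  let f := M.mulVecLin
  let e : (Fin M.rank → ℝ) ≃ₗ[ℝ] LinearMap.range f :=
    (LinearEquiv.ofFinrankEq (LinearMap.range f) (Fin M.rank → ℝ)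
      (by rw [Module.finrank_fin_fun]; rfl)).symm
  obtain ⟨s, hs⟩ := f.rangeRestrict.exists_rightInverse_of_surjective f.range_rangeRestrict
  obtain ⟨p, hp⟩ := ((LinearMap.range f).subtype ∘ₗ e.toLinearMap).exists_leftInverse_of_injective
    (LinearMap.ker_eq_bot.2 (Subtype.val_injective.comp e.injective))
  refine ⟨p.toMatrix', (s ∘ₗ e.toLinearMap).toMatrix', ?_⟩
  have hM : f.toMatrix' = M := LinearMap.toMatrix'_toLin' M
  have h : ∀ v, f (s v) = v := fun v => congrArg Subtype.val (LinearMap.congr_fun hs v)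
  have hcomp : p ∘ₗ f ∘ₗ s ∘ₗ e.toLinearMap = LinearMap.id := by
    rw [← hp]
    exact LinearMap.ext fun x => congrArg p (h (e x))
  calc p.toMatrix' * M * (s ∘ₗ e.toLinearMap).toMatrix'
      = p.toMatrix' * (f.toMatrix' * (s ∘ₗ e.toLinearMap).toMatrix') := by
        rw [hM, Matrix.mul_assoc]
    _ = 1 := by
        rw [← LinearMap.toMatrix'_comp, ← LinearMap.toMatrix'_comp, hcomp, LinearMap.toMatrix'_id]

/-- In a linear family of matrices, almost every member has maximal rank. -/
lemma ae_forall_rank_le {E ρ C : Type*} [NormedAddCommGroup E] [NormedSpace ℝ E]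
    [FiniteDimensional ℝ E] [MeasurableSpace E] [BorelSpace E] (μ : Measure E)
    [μ.IsAddHaarMeasure] [Fintype ρ] [Fintype C] (N : E →ₗ[ℝ] Matrix ρ C ℝ) :
    ∀ᵐ d ∂μ, ∀ d', (N d').rank ≤ (N d).rank := by
  classical
  have hbdd : BddAbove (Set.range fun d => (N d).rank) :=
    ⟨Fintype.card C, by rintro _ ⟨d, rfl⟩; exact Matrix.rank_le_card_width _⟩
  obtain ⟨d₀, hd₀⟩ : ∃ d₀, ∀ d', (N d').rank ≤ (N d₀).rank := by
    obtain ⟨d₀, hd₀⟩ := Nat.sSup_mem (Set.range_nonempty fun d => (N d).rank) hbdd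
    exact ⟨d₀, fun d' => (le_csSup hbdd ⟨d', rfl⟩).trans hd₀.ge⟩
  obtain ⟨P, Q, hPQ⟩ := (N d₀).exists_mul_mul_eq_one
  have hcont : Continuous fun d => (P * N d * Q).det := by
    have := N.continuous_of_finiteDimensional
    fun_prop
  have hae : ∀ᵐ d ∂μ, d ∈ {d | (P * N d * Q).det ≠ 0} := by
    -- By Fubini it suffices to look at lines in direction `d₀`. Since `P * N d₀ * Q = 1`, the
    -- determinant there is a monic polynomial in `t`, with finitely many roots.
    refine ae_mem_of_ae_add_linearMap_mem (μ := volume) (LinearMap.toSpanSingleton ℝ E d₀) μ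
      (isOpen_ne_fun hcont continuous_const).measurableSet fun y => ?_
    have hdet : ∀ t : ℝ, (P * N (y + t • d₀) * Q).det = (-(P * N y * Q)).charpoly.eval t := by
      intro t
      rw [Matrix.eval_charpoly, map_add, map_smul, Matrix.mul_add, Matrix.add_mul,
        Matrix.mul_smul, Matrix.smul_mul, hPQ, sub_neg_eq_add, add_comm, Matrix.smul_one_eq_diagonal]
      rfl
    have hfin := Polynomial.finite_setOfPred_isRoot
      (Matrix.charpoly_monic (-(P * N y * Q))).ne_zero
    filter_upwards [hfin.countable.ae_notMem volume] with t ht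
    change (P * N (y + t • d₀) * Q).det ≠ 0
    rwa [hdet]
  filter_upwards [hae] with d hd d'
  calc (N d').rank ≤ (N d₀).rank := hd₀ d'
    _ = (P * N d * Q).rank := by rw [Matrix.rank_of_det_ne_zero hd, Fintype.card_fin]
    _ ≤ (N d).rank := (Matrix.rank_mul_le_left _ _).trans (Matrix.rank_mul_le_right _ _)

/-! ### Blockwise diagonal scalings and first-order optimality -/

/-- The columns of `b` are grouped in blocks by `κ`, and the block `i` is multiplied from the left
by the diagonal matrix with diagonal entries `d i`. -/
def blockScale {ι ρ C : Type*} (κ : C → ι) (b : Matrix ρ C ℝ) :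
    (ι → ρ → ℝ) →ₗ[ℝ] Matrix ρ C ℝ where
  toFun d := Matrix.of fun r c => d (κ c) r * b r c
  map_add' d d' := by ext; simp [add_mul]
  map_smul' a d := by ext; simp [mul_assoc]

/-- The contribution of the block `i` to the matrix-vector product `b *ᵥ x`. -/
def blockMulVec {ι ρ C : Type*} [DecidableEq ι] [Fintype C] (κ : C → ι) (b : Matrix ρ C ℝ)
    (i : ι) : (C → ℝ) →ₗ[ℝ] (ρ → ℝ) :=
  (Matrix.of fun r c => if κ c = i then b r c else 0).mulVecLin

section
variable {ι ρ C : Type*} [DecidableEq ι] [Fintype C]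

lemma blockMulVec_apply (κ : C → ι) (b : Matrix ρ C ℝ) (i : ι) (x : C → ℝ) (r : ρ) :
    blockMulVec κ b i x r = ∑ c, (if κ c = i then b r c else 0) * x c := rfl

lemma blockScale_mulVec [Fintype ι] (κ : C → ι) (b : Matrix ρ C ℝ) (d : ι → ρ → ℝ) (x : C → ℝ)
    (r : ρ) : (blockScale κ b d *ᵥ x) r = ∑ i, d i r * blockMulVec κ b i x r := by
  simp_rw [blockMulVec_apply, Finset.mul_sum]
  rw [Finset.sum_comm]
  simp [blockScale, Matrix.mulVec, dotProduct, mul_assoc]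

lemma rank_add_finrank_ker [Fintype ρ] (M : Matrix ρ C ℝ) :
    M.rank + Module.finrank ℝ (LinearMap.ker M.mulVecLin) = Fintype.card C := by
  rw [← Module.finrank_fintype_fun_eq_card ℝ, ← M.mulVecLin.finrank_range_add_finrank_ker]
  rfl

/-- First-order optimality: if no rescaling has larger rank, then left and right kernel vectors
have disjoint supports blockwise. -/
lemma mul_blockMulVec_eq_zero [Fintype ι] [Fintype ρ] [DecidableEq ρ] (κ : C → ι)
    (b : Matrix ρ C ℝ) (d : ι → ρ → ℝ)
    (hd : ∀ d', (blockScale κ b d').rank ≤ (blockScale κ b d).rank) (y : ρ → ℝ)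
    (hy : y ᵥ* blockScale κ b d = 0) (x : C → ℝ) (hx : blockScale κ b d *ᵥ x = 0)
    (i : ι) (r : ρ) : y r * blockMulVec κ b i x r = 0 := by
  by_contra hne
  let e : ι → ρ → ℝ := Pi.single i (Pi.single r 1)
  have he : ∀ z, blockScale κ b e *ᵥ z = Pi.single r (blockMulVec κ b i z r) := by
    intro z
    ext s
    rw [blockScale_mulVec, Finset.sum_eq_single i (fun j _ hj => by simp [e, hj]) (by simp)]
    rcases eq_or_ne s r with rfl | hs
    · simp [e]
    · simp [e, hs]
  -- Raising the single entry `d i r` by 1 would shrink the kernel: pairing with `y` shows that the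
  -- new kernel lies in the old one, and it loses `x`.
  have hlt : LinearMap.ker (blockScale κ b (d + e)).mulVecLin <
      LinearMap.ker (blockScale κ b d).mulVecLin := by
    refine lt_of_le_of_ne (fun z hz => ?_) fun h => ?_
    · rw [LinearMap.mem_ker, Matrix.mulVecLin_apply, map_add, Matrix.add_mulVec, he] at hz
      have h := congrArg (y ⬝ᵥ ·) hz
      simp only [dotProduct_add, Matrix.dotProduct_mulVec, hy, zero_dotProduct, zero_add,
        dotProduct_single, dotProduct_zero] at h
      rw [(mul_eq_zero.1 h).resolve_left (left_ne_zero_of_mul hne), Pi.single_zero, add_zero] at hz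
      exact hz
    · have hx' : x ∈ LinearMap.ker (blockScale κ b (d + e)).mulVecLin := h ▸ hx
      rw [LinearMap.mem_ker, Matrix.mulVecLin_apply, map_add, Matrix.add_mulVec, he, hx,
        zero_add, Pi.single_eq_zero_iff] at hx'
      exact right_ne_zero_of_mul hne hx'
  have h1 := Submodule.finrank_lt_finrank_of_lt hlt
  have h2 := rank_add_finrank_ker (blockScale κ b (d + e))
  have h3 := rank_add_finrank_ker (blockScale κ b d)
  have h4 := hd (d + e)
  omega

end

/-! ### Sparse subspaces and the rank defect -/

lemma finrank_sparseSubspace {n : ℕ} (J : Finset (Fin n)) :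
    Module.finrank ℝ (sparseSubspace J) = J.card := by
  let e : sparseSubspace J ≃ₗ[ℝ] (J → ℝ) :=
    { toFun := fun v j => v.1 j
      map_add' := fun _ _ => rfl
      map_smul' := fun _ _ => rfl
      invFun := fun w => ⟨fun j => if h : j ∈ J then w ⟨j, h⟩ else 0, fun j hj => by simp [hj]⟩
      left_inv := fun v => by
        ext j
        by_cases hj : j ∈ J
        · simp [hj]
        · simp [hj, v.2 j hj]
      right_inv := fun w => by ext j; simp }
  rw [e.finrank_eq, Module.finrank_fintype_fun_eq_card, Fintype.card_coe]

/-- The coefficient vectors for which every block contributes a vector supported in `J`. -/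
def sparseCoeff {n : ℕ} {ι C : Type*} [DecidableEq ι] [Fintype C] (κ : C → ι)
    (b : Matrix (Fin n) C ℝ) (J : Finset (Fin n)) : Submodule ℝ (C → ℝ) :=
  ⨅ i, (sparseSubspace J).comap (blockMulVec κ b i)

section
variable {n : ℕ} {ι C : Type*} [DecidableEq ι] [Fintype C]

lemma mem_sparseCoeff (κ : C → ι) (b : Matrix (Fin n) C ℝ) (J : Finset (Fin n)) (x : C → ℝ) :
    x ∈ sparseCoeff κ b J ↔ ∀ i, ∀ j ∉ J, blockMulVec κ b i x j = 0 := by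
  simp only [sparseCoeff, Submodule.mem_iInf, Submodule.mem_comap]
  rfl

/-- Rank-nullity for the restriction to `sparseCoeff κ b J`, whose image lies in `S_J` and whose
kernel lies in the full kernel. -/
lemma finrank_sparseCoeff_add_rank_le [Fintype ι] (κ : C → ι) (b : Matrix (Fin n) C ℝ) (J : Finset (Fin n))
    (d : ι → Fin n → ℝ) :
    Module.finrank ℝ (sparseCoeff κ b J) + (blockScale κ b d).rank ≤ J.card + Fintype.card C := by
  let f := (blockScale κ b d).mulVecLin
  have h1 := (f.domRestrict (sparseCoeff κ b J)).finrank_range_add_finrank_ker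
  have h2 : Module.finrank ℝ (LinearMap.range (f.domRestrict (sparseCoeff κ b J))) ≤ J.card := by
    rw [← finrank_sparseSubspace J]
    refine Submodule.finrank_mono ?_
    rintro _ ⟨x, rfl⟩ j hj
    change (blockScale κ b d *ᵥ x.1) j = 0
    rw [blockScale_mulVec]
    exact Finset.sum_eq_zero fun i _ => by rw [(mem_sparseCoeff κ b J x.1).1 x.2 i j hj, mul_zero]
  have h3 : Module.finrank ℝ (LinearMap.ker (f.domRestrict (sparseCoeff κ b J))) ≤
      Module.finrank ℝ (LinearMap.ker f) := by
    rw [← Submodule.finrank_map_subtype_eq]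
    refine Submodule.finrank_mono ?_
    rintro _ ⟨x, hx, rfl⟩
    exact hx
  have h4 : _ + Module.finrank ℝ (LinearMap.ker f) = _ := rank_add_finrank_ker (blockScale κ b d)
  omega

/-- The rows outside `A` are replaced by zero. -/
def maskRows {ρ C : Type*} [DecidableEq ρ] (A : Finset ρ) (b : Matrix ρ C ℝ) : Matrix ρ C ℝ :=
  Matrix.of fun r c => if r ∈ A then b r c else 0

/-- At a scaling that maximizes the rank of all row restrictions simultaneously, the rank defect is
witnessed by a set of rows: the complement of the support of the left kernel. -/
lemma exists_card_add_card_le [Fintype ι] (κ : C → ι) (b : Matrix (Fin n) C ℝ) (d : ι → Fin n → ℝ)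
    (hd : ∀ A d', (blockScale κ (maskRows A b) d').rank ≤ (blockScale κ (maskRows A b) d).rank) :
    ∃ J : Finset (Fin n), J.card + Fintype.card C ≤
      Module.finrank ℝ (sparseCoeff κ b J) + (blockScale κ b d).rank := by
  classical
  let M := blockScale κ b d
  let A : Finset (Fin n) := {r | ∃ y, y ᵥ* M = 0 ∧ y r ≠ 0}
  -- Left kernel vectors of `M` are supported in `A`, so they also kill `M'`. Optimality of `M'`
  -- then constrains the larger space `ker M'`, not just `ker M`.
  let M' := blockScale κ (maskRows A b) d
  have hM' : ∀ y : Fin n → ℝ, (∀ r ∉ A, y r = 0) → y ᵥ* M' = y ᵥ* M := by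
    intro y hy
    ext c
    refine Finset.sum_congr (rfl : (Finset.univ : Finset (Fin n)) = _) fun r _ => ?_
    by_cases hr : r ∈ A
    · simp [M, M', blockScale, maskRows, hr]
    · simp [hy r hr]
  have hsupp : ∀ y, y ᵥ* M = 0 → ∀ r ∉ A, y r = 0 := by
    intro y hy r hr
    by_contra h
    exact hr (Finset.mem_filter.2 ⟨Finset.mem_univ r, y, hy, h⟩)
  refine ⟨Aᶜ, ?_⟩
  have hker : LinearMap.ker M'.mulVecLin ≤ sparseCoeff κ b Aᶜ := by
    intro x hx
    rw [mem_sparseCoeff]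
    intro i j hj
    rw [Finset.mem_compl, not_not] at hj
    obtain ⟨y, hy, hyj⟩ := (Finset.mem_filter.1 hj).2
    have h := mul_blockMulVec_eq_zero κ (maskRows A b) d (hd A) y
      ((hM' y (hsupp y hy)).trans hy) x hx i j
    have h' := (mul_eq_zero.1 h).resolve_left hyj
    simpa [blockMulVec_apply, maskRows, hj] using h'
  -- The left kernel of `M'` contains the left kernel of `M` and, independently, every vector
  -- supported on the erased rows.
  have hrank : M'.rank + (Aᶜ).card ≤ M.rank := by
    have hsup : LinearMap.ker Mᵀ.mulVecLin ⊔ sparseSubspace Aᶜ ≤ LinearMap.ker M'ᵀ.mulVecLin := by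
      refine sup_le (fun y hy => ?_) fun y hy => ?_
      · rw [LinearMap.mem_ker, Matrix.mulVecLin_apply, Matrix.mulVec_transpose] at hy ⊢
        rw [hM' y (hsupp y hy), hy]
      · rw [LinearMap.mem_ker, Matrix.mulVecLin_apply, Matrix.mulVec_transpose]
        ext c
        refine Finset.sum_eq_zero (s := (Finset.univ : Finset (Fin n))) fun r _ => ?_
        by_cases hr : r ∈ A
        · rw [hy r (by simpa using hr), zero_mul]
        · simp [M', blockScale, maskRows, hr]
    have hinf : LinearMap.ker Mᵀ.mulVecLin ⊓ sparseSubspace Aᶜ = ⊥ := by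
      rw [eq_bot_iff]
      rintro y ⟨hy, hy'⟩
      rw [SetLike.mem_coe, LinearMap.mem_ker, Matrix.mulVecLin_apply,
        Matrix.mulVec_transpose] at hy
      ext r
      by_cases hr : r ∈ A
      · exact hy' r (by simpa using hr)
      · exact hsupp y hy r hr
    have h1 := Submodule.finrank_sup_add_finrank_inf_eq (LinearMap.ker Mᵀ.mulVecLin)
      (sparseSubspace Aᶜ)
    rw [hinf, finrank_bot, finrank_sparseSubspace] at h1
    have h2 := Submodule.finrank_mono hsup
    have h3 := rank_add_finrank_ker Mᵀ
    have h4 := rank_add_finrank_ker M'ᵀ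
    rw [Matrix.rank_transpose] at h3 h4
    omega
  have h1 := Submodule.finrank_mono hker
  have h2 := rank_add_finrank_ker M'
  change _ ≤ _ + M.rank
  omega

end

/-! ### Columns selected from the blocks -/

section
variable {n K : ℕ} {m : Fin K → ℕ}

/-- The columns with indices in `Y i` of the matrices `B i`, side by side. -/
def selectedCols (B : (i : Fin K) → Matrix (Fin n) (Fin (m i)) ℝ)
    (Y : (i : Fin K) → Finset (Fin (m i))) : Matrix (Fin n) ((i : Fin K) × Y i) ℝ :=
  Matrix.of fun r c => B c.1 r c.2

lemma blockScale_selectedCols (B : (i : Fin K) → Matrix (Fin n) (Fin (m i)) ℝ)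
    (Y : (i : Fin K) → Finset (Fin (m i))) (d : Fin K → Fin n → ℝ) :
    blockScale Sigma.fst (selectedCols B Y) d =
      (scaledConcat d B).submatrix id fun c => ⟨c.1, c.2⟩ := by
  ext r c
  simp [blockScale, selectedCols, scaledConcat, Matrix.diagonal_mul]

lemma blockMulVec_selectedCols (B : (i : Fin K) → Matrix (Fin n) (Fin (m i)) ℝ)
    (Y : (i : Fin K) → Finset (Fin (m i))) (i : Fin K) (x : ((i : Fin K) × Y i) → ℝ) :
    blockMulVec Sigma.fst (selectedCols B Y) i x = ∑ y : Y i, x ⟨i, y⟩ • fun r => B i r y := by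
  ext r
  rw [blockMulVec_apply, Fintype.sum_sigma, Finset.sum_eq_single i
    (fun j _ hj => by simp [hj]) (by simp), Finset.sum_apply]
  simp [selectedCols, mul_comm]

lemma linearIndependent_cols {p : ℕ} {A : Matrix (Fin n) (Fin p) ℝ} (hA : A.rank = p)
    (Y : Finset (Fin p)) : LinearIndependent ℝ fun (y : Y) r => A r y := by
  have h : LinearIndependent ℝ A.col := by
    rw [linearIndependent_iff_card_eq_finrank_span, Set.finrank,
      ← Matrix.rank_eq_finrank_span_cols, hA, Fintype.card_fin]
  exact h.comp _ Subtype.val_injective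

lemma mem_colSpan {p : ℕ} (A : Matrix (Fin n) (Fin p) ℝ) (Y : Finset (Fin p)) (v : Fin n → ℝ) :
    v ∈ colSpan A Y ↔ ∃ g : Y → ℝ, ∑ y, g y • (fun r => A r y) = v := by
  rw [colSpan, Set.image_eq_range]
  exact Submodule.mem_span_range_iff_exists_fun ℝ (v := fun (y : Y) r => A r y)

/-- Full column rank makes the coefficients of each block unique, so a coefficient vector amounts to
a tuple of block contributions. -/
lemma finrank_sparseCoeff_selectedCols (B : (i : Fin K) → Matrix (Fin n) (Fin (m i)) ℝ)
    (hB : ∀ i, (B i).rank = m i) (Y : (i : Fin K) → Finset (Fin (m i))) (J : Finset (Fin n)) :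
    Module.finrank ℝ (sparseCoeff Sigma.fst (selectedCols B Y) J) =
      ∑ i, Module.finrank ℝ ↥(sparseSubspace J ⊓ colSpan (B i) (Y i)) := by
  let V := sparseCoeff Sigma.fst (selectedCols B Y) J
  let φ := fun i => blockMulVec (Sigma.fst : ((i : Fin K) × Y i) → Fin K) (selectedCols B Y) i
  let Φ : V →ₗ[ℝ] (i : Fin K) → ↥(sparseSubspace J ⊓ colSpan (B i) (Y i)) :=
    LinearMap.pi fun i => ((φ i).domRestrict V).codRestrict _ fun x =>
      ⟨(mem_sparseCoeff _ _ J x.1).1 x.2 i,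
        (mem_colSpan _ _ _).2 ⟨_, (blockMulVec_selectedCols B Y i x.1).symm⟩⟩
  have hinj : Function.Injective Φ := by
    rw [← LinearMap.ker_eq_bot, LinearMap.ker_eq_bot']
    intro x hx
    ext c
    have h : φ c.1 x.1 = 0 := congrArg Subtype.val (congrFun hx c.1)
    exact Fintype.linearIndependent_iff.1 (linearIndependent_cols (hB c.1) (Y c.1)) _
      ((blockMulVec_selectedCols B Y c.1 x.1).symm.trans h) c.2
  have hsurj : Function.Surjective Φ := by
    intro v
    choose g hg using fun i => (mem_colSpan _ _ _).1 (v i).2.2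
    have hφ : ∀ i, φ i (fun c => g c.1 c.2) = (v i).1 := fun i =>
      (blockMulVec_selectedCols B Y i _).trans (hg i)
    refine ⟨⟨fun c => g c.1 c.2, (mem_sparseCoeff _ _ J _).2 fun i j hj => ?_⟩, ?_⟩
    · exact (congrFun (hφ i) j).trans ((v i).2.1 j hj)
    · exact funext fun i => Subtype.ext (hφ i)
  rw [(LinearEquiv.ofBijective Φ ⟨hinj, hsurj⟩).finrank_eq, Module.finrank_pi_fintype]

/-- A matrix of rank at most `R` attains its rank on some `R` of its columns. -/
lemma exists_selectedCols_rank_eq (B : (i : Fin K) → Matrix (Fin n) (Fin (m i)) ℝ)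
    (d : Fin K → Fin n → ℝ) {R : ℕ} (h₁ : (scaledConcat d B).rank ≤ R) (h₂ : R ≤ ∑ i, m i) :
    ∃ Y : (i : Fin K) → Finset (Fin (m i)), ∑ i, (Y i).card = R ∧
      (scaledConcat d B).rank ≤ (blockScale Sigma.fst (selectedCols B Y) d).rank := by
  classical
  let M := scaledConcat d B
  obtain ⟨s, hs, hspan, hli⟩ := exists_linearIndependent ℝ (Set.range M.col)
  obtain ⟨T₀, hT₀⟩ : ∃ T : Finset ((i : Fin K) × Fin (m i)),
      T.card = M.rank ∧ M.rank ≤ Module.finrank ℝ (Submodule.span ℝ (M.col '' T)) := by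
    choose f hf using fun v : s => hs v.2
    have : Fintype s := ((Set.finite_range M.col).subset hs).fintype
    have hfinj : Function.Injective f := fun v w h => Subtype.ext (by rw [← hf v, ← hf w, h])
    refine ⟨Finset.univ.image f, ?_, ?_⟩
    · rw [Finset.card_image_of_injective _ hfinj, Finset.card_univ,
        Matrix.rank_eq_finrank_span_cols, ← hspan, ← Set.toFinset_card,
        finrank_span_set_eq_card hli]
    · rw [Matrix.rank_eq_finrank_span_cols, ← hspan]
      refine Submodule.finrank_mono (Submodule.span_mono fun v hv => ?_)
      exact ⟨f ⟨v, hv⟩, by simp, hf ⟨v, hv⟩⟩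
  -- (C2) speaks of exactly `R` columns, so the column basis is padded.
  obtain ⟨T, hT, hTcard⟩ := Finset.exists_superset_card_eq (n := R) (hT₀.1.trans_le h₁)
    (by simpa using h₂)
  refine ⟨fun i => {y | (⟨i, y⟩ : (i : Fin K) × Fin (m i)) ∈ T}, ?_, ?_⟩
  · rw [← hTcard, ← Finset.card_sigma]
    congr 1
    ext c
    simp
  · refine hT₀.2.trans ?_
    rw [Matrix.rank_eq_finrank_span_cols, blockScale_selectedCols]
    refine Submodule.finrank_mono (Submodule.span_mono ?_)
    rintro _ ⟨c, hc, rfl⟩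
    exact ⟨⟨c.1, ⟨c.2, by simpa using hT hc⟩⟩, rfl⟩

end

theorem theorem1 {n K : ℕ} (m : Fin K → ℕ)
    (B : (i : Fin K) → Matrix (Fin n) (Fin (m i)) ℝ)
    (hB : ∀ i, (B i).rank = m i)
    {Ω : Type*} [MeasurableSpace Ω] (P : MeasureTheory.Measure Ω)
    [MeasureTheory.IsProbabilityMeasure P]
    (L : Ω → Fin K → Fin n → ℝ) (hL : AEMeasurable L P)
    (hcont : (P.map L).AbsolutelyContinuous MeasureTheory.volume)
    (R : ℕ) (hR : R = min (∑ i, m i) n) (τ : ℕ) (hτ : 0 < τ) :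
    (∀ᵐ ω ∂P, ((scaledConcat (L ω) B).rank : ℤ) ≤ (R : ℤ) - (τ : ℤ)) ↔
      ∀ Y : (i : Fin K) → Finset (Fin (m i)), ∑ i, (Y i).card = R →
        ∃ J : Finset (Fin n),
          J.card + τ ≤
            ∑ i, Module.finrank ℝ ↥(sparseSubspace J ⊓ colSpan (B i) (Y i)) := by
  have hcard : ∀ Y : (i : Fin K) → Finset (Fin (m i)),
      Fintype.card ((i : Fin K) × Y i) = ∑ i, (Y i).card := fun Y => by simp
  constructor
  · intro h Y hY
    -- There are finitely many row sets `A`, so one null set serves them all.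
    have hgen : ∀ᵐ ω ∂P, ∀ A d', (blockScale Sigma.fst (maskRows A (selectedCols B Y)) d').rank ≤
        (blockScale Sigma.fst (maskRows A (selectedCols B Y)) (L ω)).rank :=
      ae_of_ae_map hL (hcont.ae_le (ae_all_iff.2 fun A => ae_forall_rank_le volume _))
    obtain ⟨ω, hω, hω'⟩ := (h.and hgen).exists
    obtain ⟨J, hJ⟩ := exists_card_add_card_le Sigma.fst (selectedCols B Y) (L ω) hω'
    refine ⟨J, ?_⟩
    have hle : (blockScale Sigma.fst (selectedCols B Y) (L ω)).rank ≤
        (scaledConcat (L ω) B).rank := by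
      rw [blockScale_selectedCols]
      exact Matrix.rank_submatrix_le _ _ _
    rw [← finrank_sparseCoeff_selectedCols B hB]
    rw [hcard, hY] at hJ
    omega
  · refine fun h => ae_of_all _ fun ω => ?_
    have hrank : (scaledConcat (L ω) B).rank ≤ R := by
      have h₁ := (scaledConcat (L ω) B).rank_le_card_width
      have h₂ := (scaledConcat (L ω) B).rank_le_card_height
      simp only [Fintype.card_sigma, Fintype.card_fin] at h₁ h₂
      exact hR ▸ le_min h₁ h₂
    obtain ⟨Y, hY, hY'⟩ := exists_selectedCols_rank_eq B (L ω) hrank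
      (hR.trans_le (min_le_left _ _))
    obtain ⟨J, hJ⟩ := h Y hY
    have h1 := finrank_sparseCoeff_add_rank_le Sigma.fst (selectedCols B Y) J (L ω)
    rw [finrank_sparseCoeff_selectedCols B hB, hcard, hY] at h1
    omega
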